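/- Let $n,m,p\ge 0$ be integers, and let $f:\mathbb{R}^n\times\mathbb{R}^m\to\mathbb{R}$ and $g=(g_1,\dots,g_p):\mathbb{R}^n\times\mathbb{R}^m\to\mathbb{R}^p$ be of class $C^2$, such that for every $x\in\mathbb{R}^n$ the function $f(x,\cdot)$ is strictly convex and each $g_i(x,\cdot)$ is convex. Suppose that for every $x\in\mathbb{R}^n$ the problem $$\min_{u\in\mathbb{R}^m} f(x,u)\quad\text{subject to}\quad g_i(x,u)\le 0,\ i=1,\dots,p,$$ has at least one (global) minimizer. Suppose also that local compact feasibility (LCF) holds at every $x\in\mathbb{R}^n$: there are a compact set $K\subset\mathbb{R}^m$ and $\delta>0$ such that for every $y\in\mathbb{R}^n$ with $\|y-x\|<\delta$ there is $u\in K$ with $g_i(y,u)\le 0$ for all $i$. Let $F:\mathbb{R}^n\times\mathbb{R}^m\to\mathbb{R}^n$ be locally Lipschitz. Then for every $x\in\mathbb{R}^n$ the problem has a unique minimizer $u^*(x)$, and for every $x\in\mathbb{R}^n$ there exists $\delta_x>0$ such that the closed-loop system $\dot y=F(y,u^*(y))$ has at least one Filippov solution $y:(-\delta_x,\delta_x)\to\mathbb{R}^n$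 with $y(0)=x$. Here, writing $X(z)=F(z,u^*(z))$, the Filippov set-valued map of $X$ is $$\mathcal{F}[X](z)=\bigcap_{\delta>0}\ \bigcap_{\mu(S)=0}\overline{\mathrm{co}}\,\{X(w): \|w-z\|\le\delta,\ w\notin S\},$$ where $\mu$ is Lebesgue measure on $\mathbb{R}^n$ and $\overline{\mathrm{co}}$ is the closed convex hull; a Filippov solution on an open interval $I$ is a function $y:I\to\mathbb{R}^n$ that is absolutely continuous on every compact subinterval of $I$ and satisfies $\dot y(t)\in\mathcal{F}[X](y(t))$ for almost every $t\in I$. -/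

import Mathlib

/-- The feasible set `{u | g(x, u) ≤ 0}` (componentwise inequality) at the parameter `x`. -/
def feasibleSet {n m p : ℕ}
    (g : EuclideanSpace ℝ (Fin n) × EuclideanSpace ℝ (Fin m) → Fin p → ℝ)
    (x : EuclideanSpace ℝ (Fin n)) : Set (EuclideanSpace ℝ (Fin m)) :=
  {u | ∀ i, g (x, u) i ≤ 0}

/-- The set `argmin_u f(x, u) s.t. g(x, u) ≤ 0` of global minimizers at the parameter `x`. -/
def argminSet {n m p : ℕ}
    (f : EuclideanSpace ℝ (Fin n) × EuclideanSpace ℝ (Fin m) → ℝ)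
    (g : EuclideanSpace ℝ (Fin n) × EuclideanSpace ℝ (Fin m) → Fin p → ℝ)
    (x : EuclideanSpace ℝ (Fin n)) : Set (EuclideanSpace ℝ (Fin m)) :=
  {u | u ∈ feasibleSet g x ∧ ∀ v ∈ feasibleSet g x, f (x, u) ≤ f (x, v)}

/-- Local compact feasibility (LCF) of the constraint `g(x, u) ≤ 0` at `x`. -/
def LocalCompactFeasibility {n m p : ℕ}
    (g : EuclideanSpace ℝ (Fin n) × EuclideanSpace ℝ (Fin m) → Fin p → ℝ)
    (x : EuclideanSpace ℝ (Fin n)) : Prop :=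
  ∃ K : Set (EuclideanSpace ℝ (Fin m)), IsCompact K ∧
    ∃ δ : ℝ, 0 < δ ∧ ∀ y : EuclideanSpace ℝ (Fin n), ‖y - x‖ < δ →
      ∃ u ∈ K, u ∈ feasibleSet g y

/-- The Filippov set-valued map of a vector field `X`:
the intersection, over all radii `δ > 0` and all Lebesgue-null sets `S`, of the closed convex
hull of `X '' (closedBall x δ \ S)`. -/
def filippovMap {n : ℕ} (X : EuclideanSpace ℝ (Fin n) → EuclideanSpace ℝ (Fin n))
    (x : EuclideanSpace ℝ (Fin n)) : Set (EuclideanSpace ℝ (Fin n)) :=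
  ⋂ (δ : ℝ) (_ : 0 < δ),
    ⋂ (S : Set (EuclideanSpace ℝ (Fin n))) (_ : MeasureTheory.volume S = 0),
      closure (convexHull ℝ (X '' (Metric.closedBall x δ \ S)))

/-- `y` is a Filippov solution of `ẏ = X(y)` on the open interval `(a, b)`: it is absolutely
continuous on every compact subinterval, and at almost every time `t ∈ (a, b)` it is
differentiable with derivative in the Filippov set at `y t`.
(Only the values of `y` on `(a, b)` matter.) -/
def IsFilippovSolutionOn {n : ℕ} (X : EuclideanSpace ℝ (Fin n) → EuclideanSpace ℝ (Fin n))
    (y : ℝ → EuclideanSpace ℝ (Fin n)) (a b : ℝ) : Prop :=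
  (∀ s t : ℝ, a < s → s ≤ t → t < b → AbsolutelyContinuousOnInterval y s t) ∧
    ∀ᵐ t : ℝ, t ∈ Set.Ioo a b → ∃ v ∈ filippovMap X (y t), HasDerivAt y v t

/-! Filippov solutions exist for any locally bounded field, without continuity or measurability, so
only local boundedness of the minimizer is needed. Near `x`, feasible points in a fixed compact set
cap the optimal value, while strict convexity forces growth away from the minimizer at `x`; a far
minimizer would give a segment crossing a sphere where every point is infeasible or too costly
(`eventually_dist_le_of_mem_argminSet`).

For existence, smooth selections of the essential hulls at scale `1 / (k + 1)` are integrated. The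
resulting curves are equi-Lipschitz, and derivatives of an ultralimit lie in the Filippov set
(`mem_filippovMap_of_tendsto`). -/

open Set Filter Topology MeasureTheory Metric
open scoped NNReal Manifold ContDiff

/-! ### Essential convex hulls and their smooth selections -/

section EssentialHull

variable {n : ℕ} {X X' : EuclideanSpace ℝ (Fin n) → EuclideanSpace ℝ (Fin n)}

/-- The essential closed convex hull of the values of `X` on the closed ball of radius `δ`. -/
def essentialHull (X : EuclideanSpace ℝ (Fin n) → EuclideanSpace ℝ (Fin n)) (δ : ℝ)
    (z : EuclideanSpace ℝ (Fin n)) : Set (EuclideanSpace ℝ (Fin n)) :=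
  ⋂ (S : Set (EuclideanSpace ℝ (Fin n))) (_ : volume S = 0),
    closure (convexHull ℝ (X '' (closedBall z δ \ S)))

theorem filippovMap_eq_iInter_essentialHull (z : EuclideanSpace ℝ (Fin n)) :
    filippovMap X z = ⋂ (δ : ℝ) (_ : 0 < δ), essentialHull X δ z := rfl

theorem convex_essentialHull (δ : ℝ) (z : EuclideanSpace ℝ (Fin n)) :
    Convex ℝ (essentialHull X δ z) :=
  convex_iInter₂ fun _ _ => (convex_convexHull ℝ _).closure

theorem isClosed_essentialHull (δ : ℝ) (z : EuclideanSpace ℝ (Fin n)) :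
    IsClosed (essentialHull X δ z) :=
  isClosed_iInter fun _ => isClosed_iInter fun _ => isClosed_closure

theorem essentialHull_subset_of_eqOn {δ ε : ℝ} {z w : EuclideanSpace ℝ (Fin n)}
    (hsub : closedBall z δ ⊆ closedBall w ε) (heq : EqOn X X' (closedBall z δ)) :
    essentialHull X δ z ⊆ essentialHull X' ε w := by
  refine iInter₂_mono fun S _ => closure_mono (convexHull_mono ?_)
  rintro _ ⟨v, hv, rfl⟩
  exact ⟨v, ⟨hsub hv.1, hv.2⟩, (heq hv.1).symm⟩

theorem essentialHull_mono {δ ε : ℝ} {z w : EuclideanSpace ℝ (Fin n)}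
    (h : δ + dist z w ≤ ε) : essentialHull X δ z ⊆ essentialHull X ε w :=
  essentialHull_subset_of_eqOn (closedBall_subset_closedBall' h) fun _ _ => rfl

theorem closure_convexHull_image_subset_closedBall {M : ℝ} (hX : ∀ z, ‖X z‖ ≤ M)
    (s : Set (EuclideanSpace ℝ (Fin n))) :
    closure (convexHull ℝ (X '' s)) ⊆ closedBall 0 M := by
  refine closure_minimal (convexHull_min ?_ (convex_closedBall _ _)) isClosed_closedBall
  rintro _ ⟨v, -, rfl⟩
  simpa using hX v

theorem norm_le_of_mem_essentialHull {M : ℝ} (hX : ∀ z, ‖X z‖ ≤ M) {δ : ℝ}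
    {z v : EuclideanSpace ℝ (Fin n)} (hv : v ∈ essentialHull X δ z) : ‖v‖ ≤ M := by
  have := closure_convexHull_image_subset_closedBall hX _ (mem_iInter₂.1 hv ∅ (by simp))
  simpa using this

/-- Null sets are closed under finite unions, so the hulls form a directed family of compact sets,
each nonempty because a ball is not null. -/
theorem essentialHull_nonempty {M : ℝ} (hX : ∀ z, ‖X z‖ ≤ M) {δ : ℝ} (hδ : 0 < δ)
    (z : EuclideanSpace ℝ (Fin n)) : (essentialHull X δ z).Nonempty := by
  let C : {S : Set (EuclideanSpace ℝ (Fin n)) // volume S = 0} →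
    Set (EuclideanSpace ℝ (Fin n)) := fun S =>
      closure (convexHull ℝ (X '' (closedBall z δ \ S.1)))
  have : Nonempty {S : Set (EuclideanSpace ℝ (Fin n)) // volume S = 0} := ⟨⟨∅, by simp⟩⟩
  have hC : (⋂ S, C S).Nonempty := by
    refine IsCompact.nonempty_iInter_of_directed_nonempty_isCompact_isClosed C ?_ ?_ ?_ ?_
    · intro S T
      refine ⟨⟨S.1 ∪ T.1, measure_union_null S.2 T.2⟩, ?_, ?_⟩
      · exact closure_mono (convexHull_mono (image_mono
          (sdiff_subset_sdiff_right subset_union_left)))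
      · exact closure_mono (convexHull_mono (image_mono
          (sdiff_subset_sdiff_right subset_union_right)))
    · intro S
      have hne : (closedBall z δ \ S.1).Nonempty := by
        by_contra h
        have hsub : closedBall z δ ⊆ S.1 := by
          rwa [not_nonempty_iff_eq_empty, sdiff_eq_empty] at h
        exact (measure_closedBall_pos volume z hδ).ne' (measure_mono_null hsub S.2)
      exact ((hne.image X).mono (subset_convexHull ℝ _)).mono subset_closure
    · exact fun S => (isCompact_closedBall 0 M).of_isClosed_subset isClosed_closure
        (closure_convexHull_image_subset_closedBall hX _)
    · exact fun S => isClosed_closure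
  obtain ⟨v, hv⟩ := hC
  exact ⟨v, mem_iInter₂.2 fun S hS => mem_iInter.1 hv ⟨S, hS⟩⟩

/-- A bounded vector field has smooth approximate selections of its essential hulls. -/
theorem exists_contDiff_mem_essentialHull {M : ℝ} (hX : ∀ z, ‖X z‖ ≤ M) {δ : ℝ} (hδ : 0 < δ) :
    ∃ G : EuclideanSpace ℝ (Fin n) → EuclideanSpace ℝ (Fin n),
      ContDiff ℝ 1 G ∧ ∀ z, G z ∈ essentialHull X δ z := by
  have hloc : ∀ z : EuclideanSpace ℝ (Fin n), ∃ c, ∀ᶠ w in 𝓝 z, c ∈ essentialHull X δ w := by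
    intro z
    obtain ⟨c, hc⟩ := essentialHull_nonempty hX (half_pos hδ) z
    refine ⟨c, ?_⟩
    filter_upwards [ball_mem_nhds z (half_pos hδ)] with w hw
    refine essentialHull_mono ?_ hc
    rw [mem_ball, dist_comm] at hw
    linarith
  -- A partition of unity glues the local constants, since the hulls are convex.
  obtain ⟨G, hG⟩ := exists_contMDiffMap_forall_mem_convex_of_local_const (n := 1)
    𝓘(ℝ, EuclideanSpace ℝ (Fin n)) (fun z => convex_essentialHull (X := X) δ z) hloc
  exact ⟨G, G.contMDiff.contDiff, hG⟩

end EssentialHull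

/-! ### Mean value inclusion, Picard–Lindelöf and limits of curves -/

section Curves

variable {E : Type*} [NormedAddCommGroup E]

/-- Mean value inclusion: a difference quotient lies in any closed convex set that contains all
the derivatives. -/
theorem Convex.slope_mem_of_hasDerivAt [NormedSpace ℝ E] {C : Set E} (hC : Convex ℝ C) (hC' : IsClosed C)
    {y y' : ℝ → E} {a b : ℝ} (hab : a < b) (hy : ∀ t ∈ Icc a b, HasDerivAt y (y' t) t)
    (hmem : ∀ t ∈ Icc a b, y' t ∈ C) : slope y a b ∈ C := by
  by_contra h
  obtain ⟨l, u, hl, hu⟩ := geometric_hahn_banach_closed_point hC hC' h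
  have hd : ∀ t ∈ Icc a b, HasDerivAt (fun t => l (y t)) (l (y' t)) t := fun t ht =>
    l.hasFDerivAt.comp_hasDerivAt t (hy t ht)
  obtain ⟨c, hc, hceq⟩ := exists_hasDerivAt_eq_slope (fun t => l (y t)) (fun t => l (y' t)) hab
    (fun t ht => (hd t ht).continuousAt.continuousWithinAt)
    (fun t ht => hd t (Ioo_subset_Icc_self ht))
  have h1 := hl _ (hmem c (Ioo_subset_Icc_self hc))
  rw [hceq] at h1
  rw [slope_def_module, map_smul, map_sub, smul_eq_mul, inv_mul_eq_div] at hu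
  linarith

/-- A bounded `C¹` vector field has solutions on any bounded symmetric time interval. -/
theorem ContDiff.exists_lipschitzOnWith_hasDerivAt [NormedSpace ℝ E]
    [FiniteDimensional ℝ E] {G : E → E} (hG : ContDiff ℝ 1 G) {M : ℝ≥0} (hM : ∀ z, ‖G z‖ ≤ M) (x : E) (T : ℝ≥0) :
    ∃ y : ℝ → E, y 0 = x ∧ LipschitzOnWith M y (Icc (-T) T) ∧
      ∀ t ∈ Ioo (-(T : ℝ)) T, HasDerivAt y (G (y t)) t := by
  have : ProperSpace E := FiniteDimensional.proper ℝ E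
  -- Speed at most `M` confines the solution to radius `M * T`, so a Lipschitz constant on that ball
  -- suffices.
  obtain ⟨K, hK⟩ := hG.contDiffOn.exists_lipschitzOnWith one_ne_zero
    (convex_closedBall x (M * T : ℝ≥0)) (isCompact_closedBall x _)
  have hpl : IsPicardLindelof (fun _ => G) (tmin := -(T : ℝ)) (tmax := T)
      ⟨0, by simp, by simp⟩ x (M * T) 0 M K :=
    { lipschitzOnWith := fun _ _ => hK
      continuousOn := fun _ _ => continuousOn_const
      norm_le := fun _ _ z _ => hM z
      mul_max_le := by simp }
  obtain ⟨y, hy0, hy⟩ := hpl.exists_eq_forall_mem_Icc_hasDerivWithinAt₀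
  exact ⟨y, hy0, (convex_Icc _ _).lipschitzOnWith_of_nnnorm_hasDerivWithin_le hy
      fun t _ => hM (y t),
    fun t ht => (hy t (Ioo_subset_Icc_self ht)).hasDerivAt (Icc_mem_nhds ht.1 ht.2)⟩

/-- Equi-Lipschitz curves through a point have a pointwise limit along an ultrafilter. -/
theorem exists_lipschitzOnWith_tendsto_ultrafilter [ProperSpace E] {ι : Type*} (U : Ultrafilter ι)
    {M : ℝ≥0} {s : Set ℝ} {y : ι → ℝ → E} (hy : ∀ k, LipschitzOnWith M (y k) s) {t₀ : ℝ}
    (ht₀ : t₀ ∈ s) {x : E} (hx : ∀ k, y k t₀ = x) :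
    ∃ z : ℝ → E, LipschitzOnWith M z s ∧ z t₀ = x ∧
      ∀ t ∈ s, Tendsto (fun k => y k t) U (𝓝 (z t)) := by
  have hlim : ∀ t, ∃ v, t ∈ s → Tendsto (fun k => y k t) U (𝓝 v) := by
    intro t
    by_cases ht : t ∈ s
    · obtain ⟨v, -, hv⟩ := (isCompact_closedBall x (M * dist t t₀)).ultrafilter_le_nhds'
        (U.map fun k => y k t) (by
          refine Filter.mem_map.2 (Filter.univ_mem' fun k => ?_)
          have := (hy k).dist_le_mul t ht t₀ ht₀
          rwa [hx k] at this)
      exact ⟨v, fun _ => hv⟩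
    · exact ⟨0, fun h => absurd h ht⟩
  choose z hz using hlim
  refine ⟨z, LipschitzOnWith.of_dist_le_mul fun a ha b hb => ?_, ?_, hz⟩
  · exact le_of_tendsto ((hz a ha).dist (hz b hb))
      (Eventually.of_forall fun k => (hy k).dist_le_mul a ha b hb)
  · refine tendsto_nhds_unique (hz t₀ ht₀) ?_
    simp only [hx]
    exact tendsto_const_nhds

end Curves

/-! ### Filippov solutions of bounded and locally bounded fields -/

section Filippov

variable {n : ℕ} {X X' : EuclideanSpace ℝ (Fin n) → EuclideanSpace ℝ (Fin n)}

theorem filippovMap_subset_of_eventuallyEq {z : EuclideanSpace ℝ (Fin n)} (h : X =ᶠ[𝓝 z] X') :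
    filippovMap X z ⊆ filippovMap X' z := by
  obtain ⟨r, hr, hball⟩ := Metric.nhds_basis_closedBall.eventually_iff.1 h
  intro v hv
  rw [filippovMap_eq_iInter_essentialHull, mem_iInter₂] at hv ⊢
  intro δ hδ
  exact essentialHull_subset_of_eqOn (closedBall_subset_closedBall (min_le_left δ r))
    (fun w hw => hball (closedBall_subset_closedBall (min_le_right δ r) hw))
    (hv (min δ r) (lt_min hδ hr))

/-- A derivative of a pointwise limit of approximate solutions lies in the Filippov set. -/
theorem mem_filippovMap_of_tendsto {M : ℝ≥0} {T : ℝ} (U : Ultrafilter ℕ)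
    (hU : (U : Filter ℕ) ≤ atTop)
    {G : ℕ → EuclideanSpace ℝ (Fin n) → EuclideanSpace ℝ (Fin n)}
    (hG : ∀ (k : ℕ) z, G k z ∈ essentialHull X (1 / ((k : ℝ) + 1)) z)
    {y : ℕ → ℝ → EuclideanSpace ℝ (Fin n)} {z : ℝ → EuclideanSpace ℝ (Fin n)}
    (hlip : ∀ k, LipschitzOnWith M (y k) (Icc (-T) T))
    (hy : ∀ k, ∀ t ∈ Ioo (-T) T, HasDerivAt (y k) (G k (y k t)) t)
    (hz : ∀ t ∈ Icc (-T) T, Tendsto (fun k => y k t) U (𝓝 (z t)))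
    {t : ℝ} (ht : t ∈ Ioo (-T) T) {v : EuclideanSpace ℝ (Fin n)} (hv : HasDerivAt z v t) :
    v ∈ filippovMap X (z t) := by
  rw [filippovMap_eq_iInter_essentialHull, mem_iInter₂]
  intro δ hδ
  have hclosed := isClosed_essentialHull (X := X) δ (z t)
  have hslope : Tendsto (slope z t) (𝓝[>] t) (𝓝 v) :=
    (hasDerivAt_iff_tendsto_slope.1 hv).mono_left
      (nhdsWithin_mono t fun s hs => (ne_of_gt hs : s ≠ t))
  refine hclosed.mem_of_tendsto hslope ?_
  -- The radius `δ` is spent in thirds: drift of `y k` on `[t, s]`, the scale of the selection, and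
  -- the gap between `y k t` and `z t`.
  have hsmall : ∀ᶠ s in 𝓝[>] t, (M : ℝ) * (s - t) < δ / 3 := by
    have : Tendsto (fun s : ℝ => (M : ℝ) * (s - t)) (𝓝 t) (𝓝 (M * (t - t))) := by
      apply Continuous.tendsto; fun_prop
    rw [sub_self, mul_zero] at this
    exact (this.mono_left nhdsWithin_le_nhds).eventually_lt_const (by linarith)
  filter_upwards [hsmall, self_mem_nhdsWithin, Ioo_mem_nhdsGT ht.2] with s hs hts hsT
  have htI := Ioo_subset_Icc_self ht
  have hsub : Icc t s ⊆ Ioo (-T) T := fun r hr => ⟨ht.1.trans_le hr.1, hr.2.trans_lt hsT.2⟩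
  have hsI : s ∈ Icc (-T) T := Ioo_subset_Icc_self (hsub (right_mem_Icc.2 (le_of_lt hts)))
  have hlim : Tendsto (fun k => slope (y k) t s) U (𝓝 (slope z t s)) := by
    simp only [slope_def_module]
    exact ((hz s hsI).sub (hz t htI)).const_smul _
  refine hclosed.mem_of_tendsto hlim ?_
  have hk : ∀ᶠ k : ℕ in U, 1 / ((k : ℝ) + 1) < δ / 3 :=
    (tendsto_one_div_add_atTop_nhds_zero_nat.mono_left hU).eventually_lt_const (by linarith)
  have hnear : ∀ᶠ k in U, dist (y k t) (z t) < δ / 3 :=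
    (hz t htI).eventually (ball_mem_nhds (z t) (by linarith : 0 < δ / 3))
  filter_upwards [hk, hnear] with k hk hnear
  refine (convex_essentialHull δ (z t)).slope_mem_of_hasDerivAt hclosed hts
    (fun r hr => hy k r (hsub hr)) fun r hr => essentialHull_mono ?_ (hG k (y k r))
  have h1 := (hlip k).dist_le_mul r (Ioo_subset_Icc_self (hsub hr)) t htI
  have h2 : dist r t ≤ s - t := by
    rw [Real.dist_eq, abs_of_nonneg (sub_nonneg.2 hr.1)]
    linarith [hr.2]
  have h3 := mul_le_mul_of_nonneg_left h2 M.2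
  have h4 := dist_triangle (y k r) (y k t) (z t)
  change (M : ℝ) * dist r t ≤ M * (s - t) at h3
  linarith

/-- A globally bounded vector field has Lipschitz Filippov solutions on any symmetric interval. -/
theorem exists_lipschitzOnWith_mem_filippovMap {M : ℝ≥0} (hX : ∀ z, ‖X z‖ ≤ M)
    (x : EuclideanSpace ℝ (Fin n)) (T : ℝ≥0) :
    ∃ y : ℝ → EuclideanSpace ℝ (Fin n), y 0 = x ∧ LipschitzOnWith M y (Icc (-T) T) ∧
      ∀ᵐ t : ℝ, t ∈ Ioo (-(T : ℝ)) T → ∃ v ∈ filippovMap X (y t), HasDerivAt y v t := by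
  choose G hGd hG using fun k : ℕ =>
    exists_contDiff_mem_essentialHull hX (δ := 1 / ((k : ℝ) + 1)) (by positivity)
  choose y hy0 hlip hy using fun k =>
    (hGd k).exists_lipschitzOnWith_hasDerivAt
      (fun z => norm_le_of_mem_essentialHull hX (hG k z)) x T
  obtain ⟨z, hzlip, hz0, hz⟩ := exists_lipschitzOnWith_tendsto_ultrafilter (hyperfilter ℕ) hlip
    (t₀ := 0) (by simp) hy0
  refine ⟨z, hz0, hzlip, ?_⟩
  filter_upwards [hzlip.ae_differentiableWithinAt_of_mem_real] with t hdiff ht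
  have hd := ((hdiff (Ioo_subset_Icc_self ht)).differentiableAt (Icc_mem_nhds ht.1 ht.2)).hasDerivAt
  exact ⟨_, mem_filippovMap_of_tendsto (hyperfilter ℕ)
    (Nat.hyperfilter_le_atTop) hG hlip hy hz ht hd, hd⟩

/-- A vector field that is bounded near a point has a local Filippov solution through it. -/
theorem exists_isFilippovSolutionOn_of_eventually_norm_le {M : ℝ}
    {x : EuclideanSpace ℝ (Fin n)} (hX : ∀ᶠ z in 𝓝 x, ‖X z‖ ≤ M) :
    ∃ δ : ℝ, 0 < δ ∧ ∃ y : ℝ → EuclideanSpace ℝ (Fin n), y 0 = x ∧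
      IsFilippovSolutionOn X y (-δ) δ := by
  classical
  obtain ⟨r, hr, hball⟩ := Metric.eventually_nhds_iff_ball.1 hX
  have hM : 0 ≤ M := (norm_nonneg _).trans hX.self_of_nhds
  lift M to ℝ≥0 using hM
  let Y := (ball x r).indicator X
  have hY : ∀ z, ‖Y z‖ ≤ M := by
    intro z
    by_cases hz : z ∈ ball x r
    · simpa [Y, hz] using hball z hz
    · simp [Y, indicator_of_notMem hz]
  -- At speed at most `M`, the curve stays in the open ball, where the truncation agrees with `X`;
  -- the `+ 1` also covers `M = 0`.
  have hδ : 0 < r / (M + 1) := by positivity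
  obtain ⟨y, hy0, hlip, hy⟩ := exists_lipschitzOnWith_mem_filippovMap hY x ⟨r / (M + 1), hδ.le⟩
  refine ⟨r / (M + 1), hδ, y, hy0, fun s t hs hst ht => ?_, ?_⟩
  · refine (hlip.mono ?_).absolutelyContinuousOnInterval
    rw [uIcc_of_le hst]
    exact Icc_subset_Icc hs.le ht.le
  · filter_upwards [hy] with t h ht
    obtain ⟨v, hv, hd⟩ := h ht
    refine ⟨v, filippovMap_subset_of_eventuallyEq ?_ hv, hd⟩
    have hmem : y t ∈ ball x r := by
      have h1 := hlip.dist_le_mul t (Ioo_subset_Icc_self ht) 0 ⟨neg_nonpos.2 hδ.le, hδ.le⟩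
      rw [hy0, dist_zero_right, Real.norm_eq_abs] at h1
      have h2 : |t| < r / (M + 1) := abs_lt.2 ht
      rw [lt_div_iff₀ (by positivity)] at h2
      rw [mem_ball]
      nlinarith [abs_nonneg t]
    filter_upwards [isOpen_ball.mem_nhds hmem] with w hw
    exact indicator_of_mem hw X

end Filippov

/-! ### Uniqueness and local boundedness of minimizers -/

section Minimizers

variable {n m p : ℕ} {f : EuclideanSpace ℝ (Fin n) × EuclideanSpace ℝ (Fin m) → ℝ}
  {g : EuclideanSpace ℝ (Fin n) × EuclideanSpace ℝ (Fin m) → Fin p → ℝ}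
  {x : EuclideanSpace ℝ (Fin n)}

theorem convex_feasibleSet (hg : ∀ i : Fin p, ConvexOn ℝ univ (fun u => g (x, u) i)) :
    Convex ℝ (feasibleSet g x) := by
  have h : feasibleSet g x = ⋂ i, {u | u ∈ univ ∧ g (x, u) i ≤ 0} := by
    ext u; simp [feasibleSet]
  rw [h]
  exact convex_iInter fun i => (hg i).convex_le 0

theorem eq_of_mem_argminSet (hf : StrictConvexOn ℝ univ (fun u => f (x, u)))
    (hg : ∀ i : Fin p, ConvexOn ℝ univ (fun u => g (x, u) i))
    {u v : EuclideanSpace ℝ (Fin m)} (hu : u ∈ argminSet f g x) (hv : v ∈ argminSet f g x) :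
    u = v :=
  (hf.subset (subset_univ _) (convex_feasibleSet hg)).eq_of_isMinOn
    (isMinOn_iff.2 hu.2) (isMinOn_iff.2 hv.2) hu.1 hv.1

/-- Feasible sublevel sets of a strictly convex problem with a minimizer are bounded. -/
theorem exists_dist_lt_of_mem_feasibleSet (hfc : Continuous f) (hgc : Continuous g)
    (hf : StrictConvexOn ℝ univ (fun u => f (x, u)))
    (hg : ∀ i : Fin p, ConvexOn ℝ univ (fun u => g (x, u) i))
    {u : EuclideanSpace ℝ (Fin m)} (hu : u ∈ argminSet f g x) (c : ℝ) :
    ∃ R : ℝ, ∀ v ∈ feasibleSet g x, f (x, v) ≤ c → dist v u < R := by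
  have hclosed : IsClosed (feasibleSet g x) := by
    simp only [feasibleSet, ofPred_forall]
    exact isClosed_iInter fun i => isClosed_le (by fun_prop) continuous_const
  have hcomp : IsCompact (sphere u 1 ∩ feasibleSet g x) := (isCompact_sphere u 1).inter_right hclosed
  -- a positive lower bound for the growth of the objective on the unit sphere
  obtain ⟨b, hb, hbound⟩ : ∃ b : ℝ, 0 < b ∧ ∀ w ∈ sphere u 1 ∩ feasibleSet g x,
      b ≤ f (x, w) - f (x, u) := by
    rcases (sphere u 1 ∩ feasibleSet g x).eq_empty_or_nonempty with he | hne
    · exact ⟨1, one_pos, by simp [he]⟩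
    · obtain ⟨w, hw, hmin⟩ := hcomp.exists_isMinOn hne
        (f := fun w => f (x, w) - f (x, u)) (by fun_prop)
      refine ⟨_, ?_, isMinOn_iff.1 hmin⟩
      refine lt_of_le_of_ne (sub_nonneg.2 (hu.2 w hw.2)) fun h => ?_
      have hwu : w ∈ argminSet f g x := ⟨hw.2, fun v hv => by linarith [hu.2 v hv]⟩
      have := eq_of_mem_argminSet hf hg hwu hu
      rw [this] at hw
      exact zero_ne_one ((dist_self u).symm.trans hw.1)
  -- Beyond distance 1 the segment from `u` to `v` meets the unit sphere, and convexity bounds the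
  -- distance by `(c - f (x, u)) / b`.
  refine ⟨max 1 ((c - f (x, u)) / b) + 1, fun v hv hvc => ?_⟩
  by_contra! hlarge
  set s := dist v u with hs
  have h1 : 1 < s := lt_of_lt_of_le (by linarith [le_max_left 1 ((c - f (x, u)) / b)]) hlarge
  have h2 : (c - f (x, u)) / b < s :=
    lt_of_lt_of_le (by linarith [le_max_right 1 ((c - f (x, u)) / b)]) hlarge
  have hs0 : 0 < s := by linarith
  have ha : 0 ≤ 1 - s⁻¹ := sub_nonneg.2 (inv_le_one_of_one_le₀ h1.le)
  have hb' : 0 ≤ s⁻¹ := by positivity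
  set w := (1 - s⁻¹) • u + s⁻¹ • v with hw
  have hwf : w ∈ feasibleSet g x := convex_feasibleSet hg hu.1 hv ha hb' (by ring)
  have hws : w ∈ sphere u 1 := by
    have : w - u = s⁻¹ • (v - u) := by rw [hw]; module
    rw [mem_sphere, dist_eq_norm, this, norm_smul, ← dist_eq_norm, ← hs, norm_inv,
      Real.norm_of_nonneg hs0.le, inv_mul_cancel₀ hs0.ne']
  have h3 := hbound w ⟨hws, hwf⟩
  have h4 : f (x, w) ≤ (1 - s⁻¹) * f (x, u) + s⁻¹ * f (x, v) :=
    hf.convexOn.2 (mem_univ u) (mem_univ v) ha hb' (by ring)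
  have h5 : b ≤ s⁻¹ * (c - f (x, u)) := by
    have := mul_le_mul_of_nonneg_left hvc hb'
    linarith
  rw [div_lt_iff₀ hb] at h2
  rw [inv_mul_eq_div, le_div_iff₀ hs0] at h5
  linarith

/-- Under local compact feasibility, the minimizers are locally bounded. -/
theorem eventually_dist_le_of_mem_argminSet (hfc : Continuous f) (hgc : Continuous g)
    (hf : ∀ x, StrictConvexOn ℝ univ (fun u => f (x, u)))
    (hg : ∀ x, ∀ i : Fin p, ConvexOn ℝ univ (fun u => g (x, u) i))
    {u : EuclideanSpace ℝ (Fin m)} (hu : u ∈ argminSet f g x)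
    (hlcf : LocalCompactFeasibility g x) :
    ∃ R : ℝ, ∀ᶠ z in 𝓝 x, ∀ v ∈ argminSet f g z, dist v u ≤ R := by
  obtain ⟨K, hK, δ, hδ, hfeas⟩ := hlcf
  obtain ⟨c, hc⟩ := hK.bddAbove_image (f := fun v => f (x, v)) (by fun_prop)
  obtain ⟨R₁, hR₁⟩ := exists_dist_lt_of_mem_feasibleSet hfc hgc (hf x) (hg x) hu (c + 1)
  obtain ⟨R₂, hR₂⟩ := hK.isBounded.subset_closedBall u
  let R := max R₁ R₂
  have hfK : ∀ᶠ z in 𝓝 x, ∀ v ∈ K, f (z, v) < c + 1 := by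
    refine hK.eventually_forall_of_forall_eventually (P := fun z v => f (z, v) < c + 1)
      fun v hv => ?_
    have hlt : f (x, v) < c + 1 := (hc (mem_image_of_mem _ hv)).trans_lt (lt_add_one c)
    exact hfc.continuousAt.eventually_lt_const hlt
  -- Both alternatives are open conditions, so compactness of the sphere makes them hold uniformly
  -- for `z` near `x`.
  have hsphere : ∀ᶠ z in 𝓝 x, ∀ w ∈ sphere u R, (∃ i, 0 < g (z, w) i) ∨ c + 1 < f (z, w) := by
    refine (isCompact_sphere u R).eventually_forall_of_forall_eventually
      (P := fun z w => (∃ i, 0 < g (z, w) i) ∨ c + 1 < f (z, w)) fun w hw => ?_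
    by_cases hwf : w ∈ feasibleSet g x
    · have hlt : c + 1 < f (x, w) := by
        by_contra! hle
        have := hR₁ w hwf hle
        rw [mem_sphere.1 hw] at this
        exact absurd this (not_lt.2 (le_max_left R₁ R₂))
      exact (hfc.continuousAt.eventually_const_lt hlt).mono fun _ h => Or.inr h
    · simp only [feasibleSet, mem_ofPred_eq, not_forall, not_le] at hwf
      obtain ⟨i, hi⟩ := hwf
      have hgi : Continuous fun q => g q i := by fun_prop
      exact (hgi.continuousAt.eventually_const_lt hi).mono fun _ h => Or.inl ⟨i, h⟩
  refine ⟨R, ?_⟩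
  filter_upwards [hfK, hsphere, ball_mem_nhds x hδ] with z hzK hzs hzδ v hv
  by_contra! hlarge
  obtain ⟨k, hkK, hkf⟩ := hfeas z (by rwa [← dist_eq_norm])
  have hkR : dist k u ≤ R := (hR₂ hkK).trans (le_max_right R₁ R₂)
  -- The crossing point is feasible by convexity, and its cost is at most `f (z, k) < c + 1` because
  -- `v` is optimal.
  obtain ⟨θ, hθ, hθR⟩ : R ∈ (fun θ : ℝ => dist (AffineMap.lineMap k v θ) u) '' Icc 0 1 := by
    refine intermediate_value_Icc zero_le_one (f := fun θ : ℝ => dist (AffineMap.lineMap k v θ) u)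
      (by have := AffineMap.lineMap_continuous (R := ℝ) (p := k) (q := v); fun_prop) ?_
    simpa using ⟨hkR, hlarge.le⟩
  have hseg : (AffineMap.lineMap k v θ : EuclideanSpace ℝ (Fin m)) = (1 - θ) • k + θ • v :=
    AffineMap.lineMap_apply_module k v θ
  have hθ' : 0 ≤ 1 - θ := sub_nonneg.2 hθ.2
  rcases hzs _ (mem_sphere.2 hθR) with ⟨i, hi⟩ | hlt
  · have hwf : (AffineMap.lineMap k v θ : EuclideanSpace ℝ (Fin m)) ∈ feasibleSet g z := by
      rw [hseg]
      exact convex_feasibleSet (hg z) hkf hv.1 hθ' hθ.1 (by ring)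
    exact absurd hi (not_lt.2 (hwf i))
  · have h1 : f (z, (1 - θ) • k + θ • v) ≤ (1 - θ) * f (z, k) + θ * f (z, v) :=
      (hf z).convexOn.2 (mem_univ k) (mem_univ v) hθ' hθ.1 (by ring)
    have h2 := mul_le_mul_of_nonneg_left (hv.2 k hkf) hθ.1
    rw [hseg] at hlt
    linarith [hzK k hkK]

end Minimizers

theorem mainTheorem8 (n m p : ℕ)
    (f : EuclideanSpace ℝ (Fin n) × EuclideanSpace ℝ (Fin m) → ℝ)
    (g : EuclideanSpace ℝ (Fin n) × EuclideanSpace ℝ (Fin m) → Fin p → ℝ)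
    (F : EuclideanSpace ℝ (Fin n) × EuclideanSpace ℝ (Fin m) → EuclideanSpace ℝ (Fin n))
    (hf : ContDiff ℝ 2 f) (hg : ContDiff ℝ 2 g)
    (hf_convex : ∀ x, StrictConvexOn ℝ Set.univ (fun u => f (x, u)))
    (hg_convex : ∀ x, ∀ i : Fin p, ConvexOn ℝ Set.univ (fun u => g (x, u) i))
    (h_min : ∀ x, (argminSet f g x).Nonempty)
    (h_lcf : ∀ x, LocalCompactFeasibility g x)
    (hF : LocallyLipschitz F) :
    ∃ ustar : EuclideanSpace ℝ (Fin n) → EuclideanSpace ℝ (Fin m),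
      (∀ x, argminSet f g x = {ustar x}) ∧
      ∀ x : EuclideanSpace ℝ (Fin n), ∃ δ : ℝ, 0 < δ ∧
        ∃ y : ℝ → EuclideanSpace ℝ (Fin n), y 0 = x ∧
          IsFilippovSolutionOn (fun z => F (z, ustar z)) y (-δ) δ := by
  choose ustar hustar using h_min
  refine ⟨ustar, fun x => eq_singleton_iff_unique_mem.2
    ⟨hustar x, fun v hv => eq_of_mem_argminSet (hf_convex x) (hg_convex x) hv (hustar x)⟩,
    fun x => ?_⟩
  obtain ⟨R, hR⟩ := eventually_dist_le_of_mem_argminSet hf.continuous hg.continuous hf_convex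
    hg_convex (hustar x) (h_lcf x)
  obtain ⟨M, hM⟩ := ((isCompact_closedBall x 1).prod
    (isCompact_closedBall (ustar x) R)).exists_bound_of_continuousOn hF.continuous.continuousOn
  refine exists_isFilippovSolutionOn_of_eventually_norm_le (M := M) ?_
  filter_upwards [hR, closedBall_mem_nhds x one_pos] with z hz hzx
  exact hM _ ⟨hzx, hz _ (hustar z)⟩
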